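/- Let $E$ be a complete separable metric space. Let $D_E[0,\infty)$ be the set of all RCLL paths $x:[0,\infty)\to E$ (right continuous on $[0,\infty)$, with left limits in $E$ at every $t>0$), equipped with the Skorokhod ($J_1$) topology: $x_n\to x$ iff there are increasing bijections $\lambda_n$ of $[0,\infty)$ with $\sup_{s<t}\bigl|\log\frac{\lambda_n(t)-\lambda_n(s)}{t-s}\bigr|\to 0$ and $\sup_{t\le T} d_E\bigl(x_n(t),x(\lambda_n(t))\bigr)\to 0$ for every $T\ge 0$. For $t\ge 0$ let $\theta_t:D_E[0,\infty)\to D_E[0,\infty)$, $(\theta_t x)(s)=x(s\wedge t)$, let $D_E[0,t]=\{x:\theta_t x=x\}$ carry the subspace topology, and let $$\mathcal F_t^{(E)}=\{\theta_t^{-1}(B): B\subseteq D_E[0,t]\text{ Borel}\},$$ a $\sigma$-algebra on $D_E[0,\infty)$. Then: 1. $D_E[0,\infty)$ and $E^*:=[0,\infty)\times D_E[0,\infty)$ (with the product topology) are Polish, i.e. separable and metrizable by a complete metric. 2. $\xi^*:[0,\infty)\times D_E[0,\infty)\to E^*$, $\xi^*(t,x)=(t,\theta_t x)$, is a stochastic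 process with RCLL paths: $x\mapsto\xi^*(t,x)$ is Borel measurable for each $t\ge0$, and $t\mapsto\xi^*(t,x)$ is RCLL in $E^*$ for each $x\in D_E[0,\infty)$. 3. Let $D_{E^*}[0,\infty)$, its topology and $\mathcal F_t^{(E^*)}$ be defined in the same way with $E^*$ in place of $E$, and let $\widetilde{\xi^*}:D_E[0,\infty)\to D_{E^*}[0,\infty)$, $x\mapsto\xi^*(\cdot,x)$. Then for every $t\ge 0$ $$\widetilde{\xi^*}^{-1}\bigl(\mathcal F_t^{(E^*)}\bigr)=\mathcal F_t^{(E)} .$$ Moreover $\mathcal F_t^{(E)}=\sigma(\pi_s: s\le t)$ and $\mathcal F_t^{(E^*)}=\sigma(\pi_s:s\le t)$, where $\pi_s$ denotes evaluation at time $s$ on $D_E[0,\infty)$, respectively on $D_{E^*}[0,\infty)$. -/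

import Mathlib

open Set Filter Topology Uniformity
open scoped NNReal MeasureTheory

/-- A path `x : [0,∞) → E` is RCLL: right continuous with left limits. -/
def IsRCLL {E : Type*} [TopologicalSpace E] (x : ℝ≥0 → E) : Prop :=
  (∀ t, ContinuousWithinAt x (Ici t) t) ∧
    ∀ t, 0 < t → ∃ l, Tendsto x (𝓝[<] t) (𝓝 l)

/-- The set `D_E[0,∞)` of RCLL paths in `E`. -/
@[ext]
structure SkorokhodSpace (E : Type*) [TopologicalSpace E] where
  toFun : ℝ≥0 → E
  isRCLL : IsRCLL toFun

namespace SkorokhodSpace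

instance {E : Type*} [TopologicalSpace E] : CoeFun (SkorokhodSpace E) (fun _ => ℝ≥0 → E) :=
  ⟨SkorokhodSpace.toFun⟩

/-- For an increasing bijection `φ` of `[0,∞)`, the condition
`sup_{s < t} |log ((φ t - φ s) / (t - s))| ≤ ε`, written without logarithms. -/
def TimeChangeLE (φ : ℝ≥0 ≃o ℝ≥0) (ε : ℝ) : Prop :=
  ∀ s t : ℝ≥0, s ≤ t →
    Real.exp (-ε) * ((t : ℝ) - s) ≤ (φ t : ℝ) - φ s ∧
      (φ t : ℝ) - φ s ≤ Real.exp ε * ((t : ℝ) - s)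

/-- Pairs of paths that are `U`-close on `[0,T]` after a time change of size at most `ε`. -/
def entourage {E : Type*} [TopologicalSpace E] (U : Set (E × E)) (T : ℝ≥0) (ε : ℝ) :
    Set (SkorokhodSpace E × SkorokhodSpace E) :=
  {p | ∃ φ : ℝ≥0 ≃o ℝ≥0, TimeChangeLE φ ε ∧ ∀ t ≤ T, (p.1 t, p.2 (φ t)) ∈ U}

theorem TimeChangeLE.refl {ε : ℝ} (hε : 0 ≤ ε) : TimeChangeLE (OrderIso.refl ℝ≥0) ε := by
  intro s t h
  have h' : (0 : ℝ) ≤ (t : ℝ) - s := sub_nonneg.2 (by exact_mod_cast h)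
  have h1 : Real.exp (-ε) ≤ 1 := Real.exp_le_one_iff.2 (by linarith)
  have h2 : 1 ≤ Real.exp ε := Real.one_le_exp hε
  simp only [OrderIso.refl_apply]
  constructor <;> nlinarith

theorem TimeChangeLE.mono {φ : ℝ≥0 ≃o ℝ≥0} {ε δ : ℝ} (h : TimeChangeLE φ ε) (hδ : ε ≤ δ) :
    TimeChangeLE φ δ := by
  intro s t hst
  have h' : (0 : ℝ) ≤ (t : ℝ) - s := sub_nonneg.2 (by exact_mod_cast hst)
  obtain ⟨a, b⟩ := h s t hst
  exact ⟨le_trans (by gcongr) a, b.trans (by gcongr)⟩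

theorem TimeChangeLE.symm {φ : ℝ≥0 ≃o ℝ≥0} {ε : ℝ} (h : TimeChangeLE φ ε) :
    TimeChangeLE φ.symm ε := by
  intro s t hst
  obtain ⟨a, b⟩ := h (φ.symm s) (φ.symm t) (φ.symm.monotone hst)
  simp only [OrderIso.apply_symm_apply] at a b
  have e : Real.exp (-ε) * Real.exp ε = 1 := by rw [← Real.exp_add]; simp
  constructor
  · calc Real.exp (-ε) * ((t : ℝ) - s)
        ≤ Real.exp (-ε) * (Real.exp ε * ((φ.symm t : ℝ) - φ.symm s)) := by gcongr
      _ = (φ.symm t : ℝ) - φ.symm s := by rw [← mul_assoc, e, one_mul]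
  · calc (φ.symm t : ℝ) - φ.symm s
        = Real.exp ε * (Real.exp (-ε) * ((φ.symm t : ℝ) - φ.symm s)) := by
          rw [← mul_assoc, mul_comm (Real.exp ε), e, one_mul]
      _ ≤ Real.exp ε * ((t : ℝ) - s) := by gcongr

theorem TimeChangeLE.trans {φ ψ : ℝ≥0 ≃o ℝ≥0} {ε δ : ℝ} (h : TimeChangeLE φ ε)
    (h' : TimeChangeLE ψ δ) : TimeChangeLE (φ.trans ψ) (ε + δ) := by
  intro s t hst
  obtain ⟨a, b⟩ := h s t hst
  obtain ⟨c, d⟩ := h' (φ s) (φ t) (φ.monotone hst)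
  simp only [OrderIso.trans_apply]
  constructor
  · calc Real.exp (-(ε + δ)) * ((t : ℝ) - s)
        = Real.exp (-δ) * (Real.exp (-ε) * ((t : ℝ) - s)) := by
          rw [← mul_assoc, ← Real.exp_add]; ring_nf
      _ ≤ Real.exp (-δ) * ((φ t : ℝ) - φ s) := by gcongr
      _ ≤ _ := c
  · calc (ψ (φ t) : ℝ) - ψ (φ s) ≤ Real.exp δ * ((φ t : ℝ) - φ s) := d
      _ ≤ Real.exp δ * (Real.exp ε * ((t : ℝ) - s)) := by gcongr
      _ = Real.exp (ε + δ) * ((t : ℝ) - s) := by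
          rw [← mul_assoc, ← Real.exp_add]; ring_nf

theorem TimeChangeLE.apply_le {φ : ℝ≥0 ≃o ℝ≥0} {ε : ℝ} (h : TimeChangeLE φ ε) (t : ℝ≥0) :
    φ t ≤ Real.toNNReal (Real.exp ε) * t := by
  have h0 : φ 0 = 0 := φ.map_bot
  obtain ⟨_, b⟩ := h 0 t bot_le
  rw [h0] at b
  rw [← NNReal.coe_le_coe, NNReal.coe_mul, Real.coe_toNNReal _ (Real.exp_pos ε).le]
  simpa using b

/-- The entourages `entourage U T ε` form a basis of a uniformity. -/
def filterBasis (E : Type*) [UniformSpace E] :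
    FilterBasis (SkorokhodSpace E × SkorokhodSpace E) where
  sets := {V | ∃ U ∈ 𝓤 E, ∃ T : ℝ≥0, ∃ ε : ℝ, 0 < ε ∧ V = entourage U T ε}
  nonempty := ⟨_, univ, univ_mem, 0, 1, one_pos, rfl⟩
  inter_sets := by
    rintro _ _ ⟨U, hU, T, ε, hε, rfl⟩ ⟨U', hU', T', ε', hε', rfl⟩
    refine ⟨_, ⟨U ∩ U', inter_mem hU hU', max T T', min ε ε', lt_min hε hε', rfl⟩, ?_⟩
    rintro p ⟨φ, hφ, h⟩
    exact ⟨⟨φ, hφ.mono (min_le_left _ _), fun t ht => (h t (ht.trans (le_max_left _ _))).1⟩,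
      ⟨φ, hφ.mono (min_le_right _ _), fun t ht => (h t (ht.trans (le_max_right _ _))).2⟩⟩

/-- The Skorokhod (J1) uniformity and topology on `D_E[0,∞)`: a sequence `x n` converges to `x`
iff there are time changes `φ n` with `sup_{s<t} |log ((φ n t - φ n s) / (t - s))| → 0` such that
`x n t` and `x (φ n t)` become close uniformly in `t ∈ [0,T]`, for every `T`. -/
instance instUniformSpace (E : Type*) [UniformSpace E] : UniformSpace (SkorokhodSpace E) :=
  UniformSpace.ofCore <| UniformSpace.Core.mkOfBasis (filterBasis E)
    (by
      rintro _ ⟨U, hU, T, ε, hε, rfl⟩ x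
      exact ⟨OrderIso.refl _, TimeChangeLE.refl hε.le, fun t _ => refl_mem_uniformity hU⟩)
    (by
      rintro _ ⟨U, hU, T, ε, hε, rfl⟩
      refine ⟨_, ⟨Prod.swap ⁻¹' U, symm_le_uniformity hU,
        Real.toNNReal (Real.exp ε) * T, ε, hε, rfl⟩, ?_⟩
      rintro ⟨x, y⟩ ⟨φ, hφ, h⟩
      refine ⟨φ.symm, hφ.symm, fun t ht => ?_⟩
      have := h (φ.symm t) ((hφ.symm.apply_le t).trans (by gcongr))
      simpa using this)
    (by
      rintro _ ⟨U, hU, T, ε, hε, rfl⟩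
      obtain ⟨U', hU', hc⟩ := comp_mem_uniformity_sets hU
      refine ⟨_, ⟨U', hU', max T (Real.toNNReal (Real.exp (ε / 2)) * T), ε / 2, half_pos hε,
        rfl⟩, ?_⟩
      rintro ⟨x, z⟩ ⟨y, ⟨φ, hφ, h⟩, ⟨ψ, hψ, h'⟩⟩
      refine ⟨φ.trans ψ, by simpa using hφ.trans hψ, fun t ht => hc ⟨y (φ t), ?_, ?_⟩⟩
      · exact h t (ht.trans (le_max_left _ _))
      · exact h' (φ t) (((hφ.apply_le t).trans (by gcongr)).trans (le_max_right _ _)))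

/-- The operator `θ_t`: the path `x` stopped at time `t`, i.e. `s ↦ x (s ∧ t)`. -/
def theta {E : Type*} [TopologicalSpace E] (t : ℝ≥0) (x : SkorokhodSpace E) :
    SkorokhodSpace E where
  toFun s := x (min s t)
  isRCLL := by
    constructor
    · intro s
      exact (x.isRCLL.1 (min s t)).comp (f := fun r => min r t)
        (by fun_prop) (fun r hr => min_le_min_right t hr)
    · intro s hs
      rcases le_or_gt s t with h | h
      · obtain ⟨l, hl⟩ := x.isRCLL.2 s hs
        refine ⟨l, hl.congr' ?_⟩
        filter_upwards [self_mem_nhdsWithin] with r hr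
        rw [min_eq_left ((le_of_lt hr).trans h)]
      · refine ⟨x t, tendsto_const_nhds.congr' ?_⟩
        filter_upwards [mem_nhdsWithin_of_mem_nhds (Ioi_mem_nhds h)] with r hr
        rw [min_eq_right (le_of_lt hr)]

theorem theta_theta {E : Type*} [TopologicalSpace E] (t : ℝ≥0) (x : SkorokhodSpace E) :
    theta t (theta t x) = theta t x := by
  ext s
  simp [theta]

/-- `D_E[0,t]`, the set of fixed points of `θ_t`, with the subspace topology of `D_E[0,∞)`. -/
abbrev upTo (E : Type*) [TopologicalSpace E] (t : ℝ≥0) : Set (SkorokhodSpace E) :=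
  Function.fixedPoints (theta t)

/-- The map `D_E[0,∞) → D_E[0,t]` induced by `θ_t`. -/
def thetaTo {E : Type*} [TopologicalSpace E] (t : ℝ≥0) (x : SkorokhodSpace E) : upTo E t :=
  ⟨theta t x, theta_theta t x⟩

/-- The σ-algebra `F_t^{(E)}` on `D_E[0,∞)`: the preimages of the Borel sets of `D_E[0,t]`
under the map induced by `θ_t`. -/
abbrev filtration (E : Type*) [UniformSpace E] (t : ℝ≥0) : MeasurableSpace (SkorokhodSpace E) :=
  (borel (upTo E t)).comap (thetaTo t)

/-- The σ-algebra `σ(π_s | s ≤ t)` on `D_E[0,∞)` generated by the evaluations up to time `t`. -/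
abbrev evalSigma (E : Type*) [TopologicalSpace E] (t : ℝ≥0) : MeasurableSpace (SkorokhodSpace E) :=
  ⨆ s : Iic t, (borel E).comap (fun x : SkorokhodSpace E => x s)

/-- The space `E* = [0,∞) × D_E[0,∞)`, with the product topology. -/
abbrev EStar (E : Type*) [TopologicalSpace E] : Type _ := ℝ≥0 × SkorokhodSpace E

/-- The process `ξ*(t, x) = (t, θ_t x)`. -/
def xiStar {E : Type*} [TopologicalSpace E] (t : ℝ≥0) (x : SkorokhodSpace E) : EStar E :=
  (t, theta t x)

end SkorokhodSpace

/-! Everything is deduced from the uniformity, so that the results for `E` apply verbatim to `EStar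
E`, which carries a product uniformity. Polishness: a controlled Cauchy sequence becomes locally
uniformly Cauchy once each path is composed with the accumulated time changes; since their sizes are
summable, these compositions converge to a time change `Λ`, and the uniform limit composed with
`Λ⁻¹` is the Skorokhod limit. Step paths with rational holding times and values in a countable dense
set are dense. Measurability: evaluations are Borel by right continuity, and those at a countable
dense set of times separate paths. By the Lusin–Souslin theorem they generate the Borel σ-algebra
(`borel_eq_iSup_eval`). Since `π_s ∘ θ_t = π_{s ∧ t}`, the stopped σ-algebra is `σ(π_s : s ≤ t)`,
for `E` and for `EStar E`. The first coordinate of `ξ*` is deterministic, so `ξ*(s)` generates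
`σ(π_r : r ≤ s)`, and the supremum over `s ≤ t` gives the last identity. -/

namespace SkorokhodSpace

/-! ### Constructing and estimating time changes -/

/-- A self-map of `[0,∞)` fixing `0` whose slopes lie in `[exp (-ε), exp ε]` is a time change. -/
theorem exists_timeChange {f : ℝ≥0 → ℝ≥0} {ε : ℝ} (h0 : f 0 = 0)
    (hf : ∀ s t : ℝ≥0, s ≤ t → Real.exp (-ε) * ((t : ℝ) - s) ≤ (f t : ℝ) - f s ∧
      (f t : ℝ) - f s ≤ Real.exp ε * ((t : ℝ) - s)) :
    ∃ φ : ℝ≥0 ≃o ℝ≥0, (∀ t, φ t = f t) ∧ TimeChangeLE φ ε := by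
  have hmono : StrictMono f := by
    intro s t hst
    have h1 : (s : ℝ) < t := by exact_mod_cast hst
    have h2 := mul_pos (Real.exp_pos (-ε)) (sub_pos.2 h1)
    have h3 := (hf s t hst.le).1
    have : (f s : ℝ) < f t := by linarith
    exact_mod_cast this
  have hlip : LipschitzWith (Real.toNNReal (Real.exp ε)) f := by
    refine LipschitzWith.of_dist_le_mul fun s t => ?_
    rw [Real.coe_toNNReal _ (Real.exp_pos ε).le, NNReal.dist_eq, NNReal.dist_eq]
    rcases le_total s t with h | h
    · have h1 : (s : ℝ) ≤ t := by exact_mod_cast h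
      have h2 : (f s : ℝ) ≤ f t := by exact_mod_cast hmono.monotone h
      rw [abs_sub_comm, abs_sub_comm (s : ℝ), abs_of_nonneg (sub_nonneg.2 h1),
        abs_of_nonneg (sub_nonneg.2 h2)]
      exact (hf s t h).2
    · have h1 : (t : ℝ) ≤ s := by exact_mod_cast h
      have h2 : (f t : ℝ) ≤ f s := by exact_mod_cast hmono.monotone h
      rw [abs_of_nonneg (sub_nonneg.2 h1), abs_of_nonneg (sub_nonneg.2 h2)]
      exact (hf t s h).2
  have hsurj : Function.Surjective f := by
    intro u
    -- The lower slope bound `exp (-ε)` forces `f b ≥ u` for this `b`, so the intermediate value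
    -- theorem applies on `[0,b]`.
    set b : ℝ≥0 := Real.toNNReal (Real.exp ε) * u with hb
    have hub : u ≤ f b := by
      have h1 := (hf 0 b bot_le).1
      rw [h0, hb, NNReal.coe_mul, Real.coe_toNNReal _ (Real.exp_pos ε).le] at h1
      have h2 : Real.exp (-ε) * (Real.exp ε * u) = u := by
        rw [← mul_assoc, ← Real.exp_add]; simp
      simp only [NNReal.coe_zero, sub_zero, h2] at h1
      exact_mod_cast h1
    obtain ⟨t, -, ht⟩ := intermediate_value_Icc (zero_le : 0 ≤ b) hlip.continuous.continuousOn
      (show u ∈ Icc (f 0) (f b) from ⟨by rw [h0]; exact zero_le, hub⟩)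
    exact ⟨t, ht⟩
  exact ⟨hmono.orderIsoOfSurjective f hsurj, fun _ => rfl, hf⟩

theorem TimeChangeLE.dist_apply_le {φ : ℝ≥0 ≃o ℝ≥0} {ε : ℝ} (h : TimeChangeLE φ ε)
    (h0 : 0 ≤ ε) (h1 : ε ≤ 1) (t : ℝ≥0) : dist (t : ℝ) (φ t) ≤ 2 * ε * t := by
  obtain ⟨a, b⟩ := h 0 t bot_le
  have hφ : φ 0 = 0 := φ.map_bot
  simp only [hφ, NNReal.coe_zero, sub_zero] at a b
  have e1 := Real.abs_exp_sub_one_le (x := ε) (by rwa [abs_of_nonneg h0])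
  have e2 := Real.abs_exp_sub_one_le (x := -ε) (by rwa [abs_neg, abs_of_nonneg h0])
  rw [abs_neg] at e2
  rw [abs_of_nonneg h0] at e1 e2
  have e1' := (abs_le.1 e1).2
  have e2' := (abs_le.1 e2).1
  have ht : (0 : ℝ) ≤ t := t.2
  rw [Real.dist_eq, abs_le]
  constructor <;> nlinarith

/-- If `exp (-ε) ≤ d' / d ≤ exp ε`, a time change of size `ε` can be preceded by the linear map
of `[0,d]` onto `[0,d']`. -/
theorem TimeChangeLE.exists_cons {φ : ℝ≥0 ≃o ℝ≥0} {ε : ℝ} (h : TimeChangeLE φ ε) {d d' : ℝ≥0}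
    (hd : 0 < d) (h1 : Real.exp (-ε) * d ≤ d') (h2 : (d' : ℝ) ≤ Real.exp ε * d) :
    ∃ ψ : ℝ≥0 ≃o ℝ≥0, TimeChangeLE ψ ε ∧ (∀ t < d, ψ t < d') ∧
      ∀ t, ψ (d + t) = d' + φ t := by
  have hφ : φ 0 = 0 := φ.map_bot
  set f : ℝ≥0 → ℝ≥0 := fun t => if t < d then t * (d' / d) else d' + φ (t - d) with hf
  have hd0 : (0 : ℝ) < d := by exact_mod_cast hd
  have q1 : Real.exp (-ε) ≤ (d' : ℝ) / d := by rwa [le_div_iff₀ hd0]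
  have q2 : (d' : ℝ) / d ≤ Real.exp ε := by rwa [div_le_iff₀ hd0]
  have hdpos : (0 : ℝ) < d' := lt_of_lt_of_le (mul_pos (Real.exp_pos _) hd0) h1
  have e1 : ∀ t, t < d → (f t : ℝ) = t * ((d' : ℝ) / d) := fun t ht => by simp [hf, ht]
  have e2 : ∀ t, f (d + t) = d' + φ t := fun t => by simp [hf]
  have hlow : ∀ s t : ℝ≥0, s ≤ t →
      Real.exp (-ε) * ((t : ℝ) - s) ≤ t * ((d' : ℝ) / d) - s * ((d' : ℝ) / d) ∧
      t * ((d' : ℝ) / d) - s * ((d' : ℝ) / d) ≤ Real.exp ε * ((t : ℝ) - s) := by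
    intro s t hst
    have : (0 : ℝ) ≤ (t : ℝ) - s := sub_nonneg.2 (by exact_mod_cast hst)
    rw [← sub_mul, mul_comm ((t : ℝ) - s)]
    constructor <;> gcongr
  obtain ⟨ψ, hψ, hψε⟩ := exists_timeChange (f := f) (ε := ε) (by simp [hf, hd]) (by
    intro s t hst
    rcases lt_or_ge t d with htd | htd
    · rw [e1 t htd, e1 s (hst.trans_lt htd)]
      exact hlow s t hst
    · obtain ⟨t, rfl⟩ := exists_add_of_le htd
      rcases lt_or_ge s d with hsd | hsd
      -- The increment is split at `d`: the linear piece before it and `φ` after it satisfy the same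
      -- slope bounds, which add up.
      · rw [e1 s hsd, e2 t]
        obtain ⟨a, b⟩ := hlow s d hsd.le
        obtain ⟨a', b'⟩ := h 0 t bot_le
        rw [mul_div_cancel₀ _ hd0.ne'] at a b
        rw [hφ] at a' b'
        push_cast at *
        constructor <;> nlinarith
      · obtain ⟨s, rfl⟩ := exists_add_of_le hsd
        rw [e2 t, e2 s]
        obtain ⟨a', b'⟩ := h s t (by simpa using hst)
        push_cast
        constructor
        · rw [show (d : ℝ) + t - (d + s) = t - s by ring]; linarith
        · rw [show (d : ℝ) + t - (d + s) = t - s by ring]; linarith)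
  refine ⟨ψ, hψε, fun t ht => ?_, fun t => by rw [hψ, e2]⟩
  have : (ψ t : ℝ) < d' := by
    rw [hψ, e1 t ht, mul_div_assoc', div_lt_iff₀ hd0, mul_comm]
    have : (t : ℝ) < d := by exact_mod_cast ht
    gcongr
  exact_mod_cast this

/-! ### Basic facts on the uniformity -/

theorem hasBasis_uniformity (E : Type*) [UniformSpace E] :
    (𝓤 (SkorokhodSpace E)).HasBasis (fun V => V ∈ (filterBasis E).sets) id :=
  (filterBasis E).hasBasis

theorem entourage_mem_uniformity {E : Type*} [UniformSpace E] {U : Set (E × E)} (hU : U ∈ 𝓤 E)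
    (T : ℝ≥0) {ε : ℝ} (hε : 0 < ε) : entourage U T ε ∈ 𝓤 (SkorokhodSpace E) :=
  (hasBasis_uniformity E).mem_of_mem (i := entourage U T ε) ⟨U, hU, T, ε, hε, rfl⟩

theorem exists_entourage_subset {E : Type*} [UniformSpace E]
    {V : Set (SkorokhodSpace E × SkorokhodSpace E)} (hV : V ∈ 𝓤 (SkorokhodSpace E)) :
    ∃ U ∈ 𝓤 E, ∃ T : ℝ≥0, ∃ ε : ℝ, 0 < ε ∧ entourage U T ε ⊆ V := by
  obtain ⟨_, ⟨U, hU, T, ε, hε, rfl⟩, h⟩ := (hasBasis_uniformity E).mem_iff.1 hV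
  exact ⟨U, hU, T, ε, hε, h⟩

theorem entourage_mono {E : Type*} [TopologicalSpace E] {U U' : Set (E × E)} {T T' : ℝ≥0}
    {ε ε' : ℝ} (hU : U ⊆ U') (hT : T' ≤ T) (hε : ε ≤ ε') :
    entourage U T ε ⊆ entourage U' T' ε' := by
  rintro p ⟨φ, hφ, h⟩
  exact ⟨φ, hφ.mono hε, fun t ht => hU (h t (ht.trans hT))⟩

theorem mem_entourage_of_forall {E : Type*} [TopologicalSpace E] {U : Set (E × E)} {T : ℝ≥0}
    {ε : ℝ} (hε : 0 ≤ ε) {x y : SkorokhodSpace E} (h : ∀ t ≤ T, (x t, y t) ∈ U) :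
    (x, y) ∈ entourage U T ε :=
  ⟨OrderIso.refl _, TimeChangeLE.refl hε, h⟩

/-- The three parameters can be driven by one index. This yields metrizability and lets completeness
be tested on sequences. -/
instance isCountablyGenerated_uniformity {E : Type*} [UniformSpace E] [(𝓤 E).IsCountablyGenerated] :
    (𝓤 (SkorokhodSpace E)).IsCountablyGenerated := by
  obtain ⟨U, hU⟩ := (𝓤 E).exists_antitone_basis
  have : (𝓤 (SkorokhodSpace E)).HasBasis (fun _ : ℕ => True)
      (fun n => entourage (U n) n ((1 : ℝ) / (n + 1))) := by
    refine ⟨fun V => ⟨fun hV => ?_, ?_⟩⟩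
    · obtain ⟨W, hW, T, ε, hε, h⟩ := exists_entourage_subset hV
      obtain ⟨n, hn⟩ := hU.mem_iff.1 hW
      obtain ⟨m, hm⟩ := exists_nat_ge T
      obtain ⟨k, hk⟩ := exists_nat_one_div_lt hε
      refine ⟨max n (max m k), trivial, Subset.trans (entourage_mono ?_ ?_ ?_) h⟩
      · exact (hU.antitone (le_max_left _ _)).trans hn
      · exact hm.trans (by exact_mod_cast (le_max_left m k).trans (le_max_right _ _))
      · refine le_trans ?_ hk.le
        have : k ≤ max n (max m k) := (le_max_right _ _).trans (le_max_right _ _)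
        gcongr
    · rintro ⟨n, -, hn⟩
      exact mem_of_superset
        (entourage_mem_uniformity (hU.mem n) _ Nat.one_div_pos_of_nat) hn
  exact HasCountableBasis.isCountablyGenerated ⟨this, to_countable _⟩

/-! ### Completeness -/

theorem tendsto_orderIso_nhdsLT (φ : ℝ≥0 ≃o ℝ≥0) (t : ℝ≥0) :
    Tendsto φ (𝓝[<] t) (𝓝[<] (φ t)) :=
  tendsto_nhdsWithin_of_tendsto_nhds_of_eventually_within _
    (φ.continuous.continuousAt.tendsto.mono_left nhdsWithin_le_nhds)
    (by filter_upwards [self_mem_nhdsWithin] with r hr using φ.strictMono hr)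

theorem _root_.IsRCLL.comp_orderIso {E : Type*} [TopologicalSpace E] {x : ℝ≥0 → E} (hx : IsRCLL x)
    (φ : ℝ≥0 ≃o ℝ≥0) : IsRCLL (fun t => x (φ t)) := by
  refine ⟨fun t => ?_, fun t ht => ?_⟩
  · exact (hx.1 (φ t)).comp (f := φ) φ.continuous.continuousWithinAt
      (fun r hr => φ.monotone hr)
  · have h0 : φ 0 = 0 := φ.map_bot
    obtain ⟨l, hl⟩ := hx.2 (φ t) (h0 ▸ φ.strictMono ht)
    exact ⟨l, hl.comp (tendsto_orderIso_nhdsLT φ t)⟩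

/-- A locally uniform limit of RCLL paths in a complete space is RCLL. -/
theorem isRCLL_of_locally_uniform_approx {E : Type*} [PseudoMetricSpace E] [CompleteSpace E]
    {z : ℝ≥0 → E}
    (h : ∀ T : ℝ≥0, ∀ ε > 0, ∃ y : ℝ≥0 → E, IsRCLL y ∧ ∀ t ≤ T, dist (z t) (y t) < ε) :
    IsRCLL z := by
  refine ⟨fun t => ?_, fun t ht => ?_⟩
  · refine continuousWithinAt_of_locally_uniform_approx_of_continuousWithinAt self_mem_Ici
      fun U hU => ?_
    obtain ⟨ε, hε, hU⟩ := Metric.mem_uniformity_dist.1 hU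
    obtain ⟨y, hy, hyz⟩ := h (t + 1) ε hε
    refine ⟨Iic (t + 1), mem_nhdsWithin_of_mem_nhds (Iic_mem_nhds (by simp)), y, hy.1 t,
      fun r hr => hU (hyz r hr)⟩
  · have : (𝓝[<] t).NeBot := nhdsLT_neBot_of_exists_lt ⟨0, ht⟩
    refine cauchy_map_iff_exists_tendsto.1 (Metric.cauchy_iff.2 ⟨inferInstance, fun ε hε => ?_⟩)
    obtain ⟨y, hy, hyz⟩ := h t (ε / 4) (by positivity)
    obtain ⟨l, hl⟩ := hy.2 t ht
    refine ⟨z '' {r | r < t ∧ dist (y r) l < ε / 4}, image_mem_map ?_, ?_⟩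
    · exact inter_mem self_mem_nhdsWithin (hl (Metric.ball_mem_nhds l (by positivity)))
    · rintro _ ⟨r, ⟨hr, hr'⟩, rfl⟩ _ ⟨s, ⟨hs, hs'⟩, rfl⟩
      have h1 := hyz r hr.le
      have h2 := hyz s hs.le
      rw [dist_comm] at h2 hs'
      have h3 := dist_triangle4 (z r) (y r) (y s) (z s)
      have h4 := dist_triangle (y r) l (y s)
      linarith

/-- The composition `φ (n - 1) ∘ ⋯ ∘ φ 0`. -/
def iterTimeChange (φ : ℕ → ℝ≥0 ≃o ℝ≥0) : ℕ → ℝ≥0 ≃o ℝ≥0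
  | 0 => OrderIso.refl _
  | n + 1 => (iterTimeChange φ n).trans (φ n)

theorem iterTimeChange_succ (φ : ℕ → ℝ≥0 ≃o ℝ≥0) (n : ℕ) (t : ℝ≥0) :
    iterTimeChange φ (n + 1) t = φ n (iterTimeChange φ n t) := rfl

theorem timeChangeLE_iterTimeChange {φ : ℕ → ℝ≥0 ≃o ℝ≥0}
    (hφ : ∀ n, TimeChangeLE (φ n) ((1 / 2) ^ n)) (n k : ℕ) :
    TimeChangeLE ((iterTimeChange φ n).symm.trans (iterTimeChange φ (n + k)))
      (2 * (1 / 2) ^ n) := by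
  -- The exact partial sum of the geometric series is what the induction can carry; the stated bound
  -- is its tail sum.
  suffices TimeChangeLE ((iterTimeChange φ n).symm.trans (iterTimeChange φ (n + k)))
      (2 * (1 / 2) ^ n - 2 * (1 / 2) ^ (n + k)) from this.mono (by simp)
  induction k with
  | zero =>
    have : (iterTimeChange φ n).symm.trans (iterTimeChange φ (n + 0)) = OrderIso.refl _ := by
      ext; simp
    rw [this]
    exact TimeChangeLE.refl (by simp)
  | succ k ih =>
    refine (ih.trans (hφ (n + k))).mono (le_of_eq ?_)
    rw [← add_assoc, pow_succ (1 / 2 : ℝ) (n + k)]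
    ring

/-- Infinite compositions of time changes with summable sizes exist. -/
theorem exists_timeChange_limit {φ : ℕ → ℝ≥0 ≃o ℝ≥0}
    (hφ : ∀ n, TimeChangeLE (φ n) ((1 / 2) ^ n)) :
    ∃ Λ : ℝ≥0 ≃o ℝ≥0, ∀ n, TimeChangeLE ((iterTimeChange φ n).symm.trans Λ) (2 * (1 / 2) ^ n) := by
  have hbound : ∀ n t, (iterTimeChange φ n t : ℝ) ≤ Real.exp 2 * t := by
    intro n t
    obtain ⟨_, b⟩ := timeChangeLE_iterTimeChange hφ 0 n 0 t bot_le
    have h0 : iterTimeChange φ n 0 = 0 := (iterTimeChange φ n).map_bot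
    have h1 : (iterTimeChange φ 0).symm t = t := rfl
    have h2 : (iterTimeChange φ 0).symm 0 = 0 := rfl
    simpa [h0, h1, h2] using b
  have hlim : ∀ t, ∃ l : ℝ≥0, Tendsto (fun n => iterTimeChange φ n t) atTop (𝓝 l) := by
    intro t
    refine cauchySeq_tendsto_of_complete
      (cauchySeq_of_le_geometric (1 / 2) (2 * Real.exp 2 * t) (by norm_num) fun n => ?_)
    have h1 := (hφ n).dist_apply_le (by positivity) (pow_le_one₀ (by norm_num) (by norm_num))
      (iterTimeChange φ n t)
    rw [iterTimeChange_succ, NNReal.dist_eq, ← Real.dist_eq]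
    refine h1.trans ?_
    calc 2 * (1 / 2 : ℝ) ^ n * (iterTimeChange φ n t : ℝ)
        ≤ 2 * (1 / 2 : ℝ) ^ n * (Real.exp 2 * t) := by gcongr; exact hbound n t
      _ = _ := by ring
  choose f hf using hlim
  have hf' : ∀ t, Tendsto (fun n => (iterTimeChange φ n t : ℝ)) atTop (𝓝 (f t)) := fun t =>
    (NNReal.continuous_coe.tendsto _).comp (hf t)
  -- Slope bounds are closed conditions, so they pass to the limit in `k`. The case `n = 0` makes
  -- `f` a time change; the other cases bound the tails.
  have key : ∀ n, ∀ s t : ℝ≥0, s ≤ t →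
      Real.exp (-(2 * (1 / 2) ^ n)) * ((iterTimeChange φ n t : ℝ) - iterTimeChange φ n s)
        ≤ (f t : ℝ) - f s ∧
      (f t : ℝ) - f s ≤
        Real.exp (2 * (1 / 2) ^ n) * ((iterTimeChange φ n t : ℝ) - iterTimeChange φ n s) := by
    intro n s t hst
    have hl : Tendsto (fun k => (iterTimeChange φ (n + k) t : ℝ) - iterTimeChange φ (n + k) s)
        atTop (𝓝 ((f t : ℝ) - f s)) := by
      have := (hf' t).sub (hf' s)
      simp_rw [add_comm n]
      exact (tendsto_add_atTop_iff_nat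
        (f := fun k => (iterTimeChange φ k t : ℝ) - iterTimeChange φ k s) n).2 this
    have hk := fun k => timeChangeLE_iterTimeChange hφ n k (iterTimeChange φ n s)
      (iterTimeChange φ n t) ((iterTimeChange φ n).monotone hst)
    simp only [OrderIso.trans_apply, OrderIso.symm_apply_apply] at hk
    exact ⟨ge_of_tendsto' hl fun k => (hk k).1, le_of_tendsto' hl fun k => (hk k).2⟩
  obtain ⟨Λ, hΛ, -⟩ := exists_timeChange (f := f) (ε := 2 * (1 / 2) ^ 0)
    (tendsto_nhds_unique (hf 0)
      (by simpa using tendsto_const_nhds.congr fun n => ((iterTimeChange φ n).map_bot).symm))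
    (key 0)
  refine ⟨Λ, fun n s t hst => ?_⟩
  have := key n _ _ ((iterTimeChange φ n).symm.monotone hst)
  simpa [hΛ] using this

theorem completeSpace_of_pseudoMetric (E : Type*) [PseudoMetricSpace E] [CompleteSpace E] :
    CompleteSpace (SkorokhodSpace E) := by
  refine UniformSpace.complete_of_convergent_controlled_sequences
    (fun n => entourage {p : E × E | dist p.1 p.2 < (1 / 2) ^ n} n ((1 / 2) ^ n))
    (fun n => entourage_mem_uniformity (Metric.dist_mem_uniformity (by positivity)) _
      (by positivity)) fun x hx => ?_
  have hstep : ∀ n : ℕ, ∃ φ : ℝ≥0 ≃o ℝ≥0, TimeChangeLE φ ((1 / 2) ^ n) ∧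
      ∀ t : ℝ≥0, t ≤ n → dist (x n t) (x (n + 1) (φ t)) < (1 / 2) ^ n :=
    fun n => hx n n (n + 1) le_rfl n.le_succ
  choose φ hφ hxφ using hstep
  obtain ⟨Λ, hΛ⟩ := exists_timeChange_limit hφ
  have hbound : ∀ n t, iterTimeChange φ n t ≤ Real.toNNReal (Real.exp 2) * t := by
    intro n t
    have := (timeChangeLE_iterTimeChange hφ 0 n).apply_le t
    simpa [iterTimeChange] using this
  set C : ℝ≥0 := Real.toNNReal (Real.exp 2) with hC
  set w : ℕ → ℝ≥0 → E := fun n t => x n (iterTimeChange φ n t) with hw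
  -- The condition `C * t ≤ n` keeps the moved time within the horizon `n` of the `n`-th entourage.
  have hwd : ∀ (n : ℕ) t, C * t ≤ n → dist (w n t) (w (n + 1) t) ≤ (1 / 2) ^ n := fun n t h =>
    (hxφ n _ ((hbound n t).trans h)).le
  -- shifting the index turns the eventual geometric bound into a genuine one
  have hlim : ∀ t, ∃ l, Tendsto (fun n => w n t) atTop (𝓝 l) ∧
      ∀ n : ℕ, C * t ≤ n → dist (w n t) l ≤ 2 * (1 / 2) ^ n := by
    intro t
    have hg : ∀ N : ℕ, C * t ≤ N → ∀ k, dist (w (k + N) t) (w (k + 1 + N) t)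
        ≤ (1 / 2) ^ N * (1 / 2) ^ k := by
      intro N hN k
      have := hwd (k + N) t (hN.trans (by simp))
      rw [pow_add, mul_comm, add_right_comm] at this
      exact this
    obtain ⟨N, hN⟩ := exists_nat_ge (C * t)
    obtain ⟨l, hl⟩ := cauchySeq_tendsto_of_complete
      (cauchySeq_of_le_geometric (1 / 2) ((1 / 2) ^ N) (by norm_num) (hg N hN))
    have hl' := (tendsto_add_atTop_iff_nat (f := fun n => w n t) N).1 hl
    refine ⟨l, hl', fun n hn => ?_⟩
    have := dist_le_of_le_geometric_of_tendsto₀ (1 / 2) ((1 / 2) ^ n) (by norm_num) (hg n hn)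
      ((tendsto_add_atTop_iff_nat (f := fun n => w n t) n).2 hl')
    rw [zero_add] at this
    refine this.trans (le_of_eq ?_)
    ring
  choose z _ hzd using hlim
  have hpow : ∀ ε > 0, ∀ᶠ n : ℕ in atTop, 2 * (1 / 2 : ℝ) ^ n < ε := by
    intro ε hε
    have := (tendsto_pow_atTop_nhds_zero_of_lt_one (r := (1 / 2 : ℝ)) (by norm_num)
      (by norm_num)).const_mul 2
    rw [mul_zero] at this
    exact this.eventually_lt_const hε
  have hzR : IsRCLL z := by
    refine isRCLL_of_locally_uniform_approx fun T ε hε => ?_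
    obtain ⟨n, hn, hn'⟩ := ((hpow ε hε).and
      (tendsto_natCast_atTop_atTop.eventually_ge_atTop (C * T))).exists
    refine ⟨w n, (x n).isRCLL.comp_orderIso _, fun t ht => ?_⟩
    rw [dist_comm]
    exact (hzd t n (le_trans (by gcongr) hn')).trans_lt hn
  refine ⟨⟨fun t => z (Λ.symm t), hzR.comp_orderIso _⟩, ?_⟩
  rw [Uniform.tendsto_nhds_left, Filter.tendsto_def]
  intro V hV
  obtain ⟨U, hU, T, ε, hε, hUV⟩ := exists_entourage_subset hV
  obtain ⟨δ, hδ, hδU⟩ := Metric.mem_uniformity_dist.1 hU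
  -- One factor `C` bounds `s`, the preimage of `t ≤ T`; the other is required by `hzd` at `s`.
  filter_upwards [hpow ε hε, hpow δ hδ,
    tendsto_natCast_atTop_atTop.eventually_ge_atTop (C * (C * T))] with n h1 h2 h3
  refine hUV ⟨_, (hΛ n).mono h1.le, fun t ht => hδU ?_⟩
  set s := (iterTimeChange φ n).symm t with hs
  have hsT : s ≤ C * T := by
    have := (timeChangeLE_iterTimeChange hφ 0 n).symm.apply_le t
    have h4 : s ≤ C * t := by simpa [iterTimeChange] using this
    exact h4.trans (by gcongr)
  have h5 := hzd s n (le_trans (by gcongr) h3)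
  have h6 : w n s = x n t := by simp [hw, hs]
  rw [h6] at h5
  have h7 : dist (x n t) (z (Λ.symm (Λ s))) < δ := by
    rw [OrderIso.symm_apply_apply]; exact h5.trans_lt h2
  exact h7

instance completeSpace {E : Type*} [UniformSpace E] [(𝓤 E).IsCountablyGenerated]
    [CompleteSpace E] : CompleteSpace (SkorokhodSpace E) := by
  let := UniformSpace.pseudoMetricSpace E
  exact completeSpace_of_pseudoMetric E

/-! ### Separability -/

/-- The constant path. -/
noncomputable def const {E : Type*} [TopologicalSpace E] (v : E) : SkorokhodSpace E where
  toFun _ := v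
  isRCLL := ⟨fun _ => continuousWithinAt_const, fun _ _ => ⟨v, tendsto_const_nhds⟩⟩

/-- The path that stays at `v` during `[0,d)` and then runs through `y`. -/
noncomputable def cons {E : Type*} [TopologicalSpace E] (v : E) (d : ℝ≥0) (y : SkorokhodSpace E) :
    SkorokhodSpace E where
  toFun t := if t < d then v else y (t - d)
  isRCLL := by
    refine ⟨fun t => ?_, fun t ht => ?_⟩
    · rcases lt_or_ge t d with h | h
      · refine ContinuousAt.continuousWithinAt (continuousAt_const (y := v) |>.congr ?_)
        filter_upwards [Iio_mem_nhds h] with r hr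
        exact (if_pos hr).symm
      · have h1 : ContinuousWithinAt (fun r => y (r - d)) (Ici t) t :=
          (y.isRCLL.1 (t - d)).comp (f := fun r => r - d) (by fun_prop)
            (fun r hr => tsub_le_tsub_right hr d)
        exact h1.congr (fun r hr => if_neg (not_lt.2 (h.trans hr))) (if_neg (not_lt.2 h))
    · rcases le_or_gt t d with h | h
      · refine ⟨v, tendsto_const_nhds.congr' ?_⟩
        filter_upwards [self_mem_nhdsWithin] with r hr
        exact (if_pos (lt_of_lt_of_le hr h)).symm
      · obtain ⟨l, hl⟩ := y.isRCLL.2 (t - d) (tsub_pos_of_lt h)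
        have hd : ∀ᶠ r in 𝓝[<] t, d < r := mem_nhdsWithin_of_mem_nhds (Ioi_mem_nhds h)
        have h1 : Tendsto (fun r => r - d) (𝓝[<] t) (𝓝[<] (t - d)) := by
          refine tendsto_nhdsWithin_of_tendsto_nhds_of_eventually_within _ ?_ ?_
          · exact ((by fun_prop : Continuous fun r : ℝ≥0 => r - d).tendsto t).mono_left
              nhdsWithin_le_nhds
          · filter_upwards [self_mem_nhdsWithin, hd] with r hr hr'
            exact tsub_lt_tsub_right_of_le hr'.le hr
        refine ⟨l, (hl.comp h1).congr' ?_⟩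
        filter_upwards [hd] with r hr
        exact (if_neg (not_lt.2 hr.le)).symm

theorem cons_apply_of_lt {E : Type*} [TopologicalSpace E] {v : E} {d t : ℝ≥0}
    (y : SkorokhodSpace E) (h : t < d) : cons v d y t = v := if_pos h

theorem cons_apply_add {E : Type*} [TopologicalSpace E] (v : E) (d t : ℝ≥0)
    (y : SkorokhodSpace E) : cons v d y (d + t) = y t := by
  simp [cons]

/-- The time change for the tails is preceded by the linear map of slope `d' / d`. Delaying by `d`
only shortens the horizon needed for the tails. -/
theorem cons_mem_entourage {E : Type*} [TopologicalSpace E] {U : Set (E × E)} {T : ℝ≥0} {ε : ℝ}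
    {v v' : E} {d d' : ℝ≥0} {y y' : SkorokhodSpace E} (hd : 0 < d)
    (h1 : Real.exp (-ε) * d ≤ d') (h2 : (d' : ℝ) ≤ Real.exp ε * d) (hv : (v, v') ∈ U)
    (hy : (y, y') ∈ entourage U T ε) : (cons v d y, cons v' d' y') ∈ entourage U T ε := by
  obtain ⟨φ, hφ, h⟩ := hy
  obtain ⟨ψ, hψ, hψ1, hψ2⟩ := hφ.exists_cons hd h1 h2
  refine ⟨ψ, hψ, fun t ht => ?_⟩
  show (cons v d y t, cons v' d' y' (ψ t)) ∈ U
  rcases lt_or_ge t d with htd | htd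
  · rwa [cons_apply_of_lt _ htd, cons_apply_of_lt _ (hψ1 t htd)]
  · obtain ⟨t, rfl⟩ := exists_add_of_le htd
    rw [hψ2, cons_apply_add, cons_apply_add]
    exact h t (le_trans (by simp) ht)

/-- The step path with given holding times and values. -/
noncomputable def step {E : Type*} [TopologicalSpace E] : List (ℝ≥0 × E) → E → SkorokhodSpace E
  | [], v => const v
  | p :: l, v => cons p.2 p.1 (step l v)

/-- Step paths with rational holding times and values in `s`. -/
def rationalSteps {E : Type*} [TopologicalSpace E] (s : Set E) : Set (SkorokhodSpace E) :=
  range fun p : List (ℚ≥0 × s) × s =>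
    step (p.1.map fun q => ((q.1 : ℝ≥0), (q.2 : E))) (p.2 : E)

theorem countable_rationalSteps {E : Type*} [TopologicalSpace E] {s : Set E} (hs : s.Countable) :
    (rationalSteps s).Countable := by
  have := hs.to_subtype
  exact countable_range _

theorem const_mem_rationalSteps {E : Type*} [TopologicalSpace E] {s : Set E} {v : E}
    (hv : v ∈ s) : const v ∈ rationalSteps s :=
  ⟨([], ⟨v, hv⟩), rfl⟩

theorem cons_mem_rationalSteps {E : Type*} [TopologicalSpace E] {s : Set E} {v : E}
    (hv : v ∈ s) (q : ℚ≥0) {y : SkorokhodSpace E} (hy : y ∈ rationalSteps s) :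
    cons v q y ∈ rationalSteps s := by
  obtain ⟨⟨l, w⟩, rfl⟩ := hy
  exact ⟨((q, ⟨v, hv⟩) :: l, w), rfl⟩

theorem const_mem_closure {E : Type*} [UniformSpace E] {s : Set E} (hs : Dense s) (v : E) :
    const v ∈ closure (rationalSteps s) := by
  refine UniformSpace.mem_closure_iff_ball.2 fun {V} hV => ?_
  obtain ⟨U, hU, T, ε, hε, h⟩ := exists_entourage_subset hV
  obtain ⟨v', hv', hv's⟩ := hs.inter_nhds_nonempty (UniformSpace.ball_mem_nhds v hU)
  exact ⟨const v', h (mem_entourage_of_forall hε.le fun _ _ => hv's),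
    const_mem_rationalSteps hv'⟩

theorem cons_mem_closure {E : Type*} [UniformSpace E] {s : Set E} (hs : Dense s) (v : E)
    {d : ℝ≥0} (hd : 0 < d) {y : SkorokhodSpace E} (hy : y ∈ closure (rationalSteps s)) :
    cons v d y ∈ closure (rationalSteps s) := by
  refine UniformSpace.mem_closure_iff_ball.2 fun {V} hV => ?_
  obtain ⟨U, hU, T, ε, hε, h⟩ := exists_entourage_subset hV
  obtain ⟨v', hv', hv's⟩ := hs.inter_nhds_nonempty (UniformSpace.ball_mem_nhds v hU)
  obtain ⟨y', hyy', hy'⟩ := UniformSpace.mem_closure_iff_ball.1 hy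
    (entourage_mem_uniformity hU T hε)
  have hd0 : (0 : ℝ) < d := by exact_mod_cast hd
  obtain ⟨q, hq1, hq2⟩ := exists_rat_btwn (show (d : ℝ) < Real.exp ε * d from
    lt_mul_of_one_lt_left hd0 (Real.one_lt_exp_iff.2 hε))
  have hq0 : 0 ≤ q := by
    have : (0 : ℝ) ≤ q := (hd0.trans hq1).le
    exact_mod_cast this
  lift q to ℚ≥0 using hq0
  refine ⟨cons v' q y', h (cons_mem_entourage hd ?_ ?_ hv's hyy'),
    cons_mem_rationalSteps hv' q hy'⟩
  · refine le_trans (mul_le_of_le_one_left hd0.le (Real.exp_le_one_iff.2 (by linarith))) ?_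
    exact_mod_cast hq1.le
  · exact_mod_cast hq2.le

/-- An RCLL path is uniformly close on `[0,T]` to limits of step paths. -/
theorem exists_mem_closure_near {E : Type*} [UniformSpace E] {s : Set E} (hs : Dense s)
    (x : SkorokhodSpace E) (T : ℝ≥0) {U : Set (E × E)} (hU : U ∈ 𝓤 E) :
    ∃ y ∈ closure (rationalSteps s), ∀ t ≤ T, (x t, y t) ∈ U := by
  -- `P a` is approximability of the path restarted at `a`, up to time `T`. The proof is a backward
  -- continuity induction from `T`, with `c` the supremum of the bad times.
  let P : ℝ≥0 → Prop := fun a => ∃ y ∈ closure (rationalSteps s), ∀ t, a + t ≤ T →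
    (x (a + t), y t) ∈ U
  have hUs := symm_le_uniformity hU
  have hcons : ∀ a b v, a < b → P b → (∀ t, a ≤ t → t < b → (x t, v) ∈ U) → P a := by
    rintro a b v hab ⟨y, hy, hyb⟩ hv
    refine ⟨cons v (b - a) y, cons_mem_closure hs v (tsub_pos_of_lt hab) hy, fun t ht => ?_⟩
    rcases lt_or_ge t (b - a) with h | h
    · rw [cons_apply_of_lt _ h]
      exact hv _ (by simp) (by rw [add_comm]; exact lt_tsub_iff_right.1 h)
    · obtain ⟨t, rfl⟩ := exists_add_of_le h
      rw [← add_assoc, add_tsub_cancel_of_le hab.le] at ht ⊢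
      rw [cons_apply_add]
      exact hyb t ht
  suffices h : ∀ a ≤ T, P a by
    obtain ⟨y, hy, h⟩ := h 0 zero_le
    exact ⟨y, hy, fun t ht => by simpa using h t (by simpa using ht)⟩
  by_contra! hne
  set B : Set ℝ≥0 := {a | a ≤ T ∧ ¬ P a} with hB
  have hBne : B.Nonempty := hne
  have hBb : BddAbove B := ⟨T, fun a ha => ha.1⟩
  set c := sSup B with hc
  have hcT : c ≤ T := csSup_le hBne fun a ha => ha.1
  have hPT : P T := ⟨const (x T), const_mem_closure hs _, fun t ht => by
    have : t = 0 := by simpa using ht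
    subst this
    rw [add_zero]
    exact refl_mem_uniformity hU⟩
  by_cases hPc : P c
  · have hcpos : 0 < c := by
      obtain ⟨a, ha⟩ := hBne
      refine lt_of_le_of_ne zero_le fun h0 => ha.2 ?_
      have : a ≤ c := le_csSup hBb ha
      have : a = c := le_antisymm this (by rw [← h0]; exact zero_le)
      rwa [this]
    -- If `c` is good, prepending the left limit at `c` makes every time slightly before `c` good,
    -- although bad times accumulate there.
    obtain ⟨l, hl⟩ := x.isRCLL.2 c hcpos
    have h1 : ∀ᶠ r in 𝓝[<] c, (x r, l) ∈ U := hl (UniformSpace.ball_mem_nhds l hUs)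
    obtain ⟨δ, hδ, hδ'⟩ := (mem_nhdsLT_iff_exists_Ioo_subset' hcpos).1 h1
    obtain ⟨b, hb, hδb⟩ := exists_lt_of_lt_csSup hBne hδ
    have hbc : b < c := lt_of_le_of_ne (le_csSup hBb hb) fun h => hb.2 (h ▸ hPc)
    exact hb.2 (hcons b c l hbc hPc fun t h1 h2 => hδ' ⟨hδb.trans_le h1, h2⟩)
  · have hcT' : c < T := lt_of_le_of_ne hcT fun h => hPc (h ▸ hPT)
    -- If `c` is bad, right continuity allows prepending the value `x c` to an approximation from a
    -- later time, which is good by the choice of `c`.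
    have h1 : ∀ᶠ r in 𝓝[≥] c, (x r, x c) ∈ U := x.isRCLL.1 c (UniformSpace.ball_mem_nhds _ hUs)
    obtain ⟨u, hu, hu'⟩ := (mem_nhdsGE_iff_exists_Ico_subset' hcT').1 h1
    set b := min u T with hb
    have hcb : c < b := lt_min hu hcT'
    have hPb : P b := by
      by_contra h
      exact absurd (le_csSup hBb (show b ∈ B from ⟨min_le_right _ _, h⟩)) (not_le.2 hcb)
    exact hPc (hcons c b (x c) hcb hPb fun t h1 h2 => hu' ⟨h1, h2.trans_le (min_le_left _ _)⟩)

theorem dense_rationalSteps {E : Type*} [UniformSpace E] {s : Set E} (hs : Dense s) :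
    Dense (rationalSteps s) := by
  intro x
  -- It suffices to approximate by elements of the closure, which is what `exists_mem_closure_near`
  -- provides.
  rw [← closure_closure]
  refine UniformSpace.mem_closure_iff_ball.2 fun {V} hV => ?_
  obtain ⟨U, hU, T, ε, hε, h⟩ := exists_entourage_subset hV
  obtain ⟨y, hy, hxy⟩ := exists_mem_closure_near hs x T hU
  exact ⟨y, h (mem_entourage_of_forall hε.le hxy), hy⟩

instance separableSpace {E : Type*} [UniformSpace E] [TopologicalSpace.SeparableSpace E] :
    TopologicalSpace.SeparableSpace (SkorokhodSpace E) := by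
  obtain ⟨s, hs, hd⟩ := TopologicalSpace.exists_countable_dense E
  exact ⟨rationalSteps s, countable_rationalSteps hs, dense_rationalSteps hd⟩

/-! ### Borel sets and evaluations -/

/-- A small time change moves `r` only slightly, hence keeps it inside the open interval. Evaluation
at one fixed time has no such stability. -/
theorem isOpen_setOf_exists_mem {E : Type*} [UniformSpace E] (a b : ℝ≥0) {U : Set E}
    (hU : IsOpen U) : IsOpen {x : SkorokhodSpace E | ∃ r, a < r ∧ r < b ∧ x r ∈ U} := by
  rw [isOpen_iff_mem_nhds]
  rintro x ⟨r, har, hrb, hr⟩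
  have har' : (a : ℝ) < r := by exact_mod_cast har
  have hrb' : (r : ℝ) < b := by exact_mod_cast hrb
  have h1 : ∀ᶠ ε : ℝ in 𝓝 0, (a : ℝ) < Real.exp (-ε) * r :=
    (by fun_prop : Continuous fun ε : ℝ => Real.exp (-ε) * r).tendsto 0 |>.eventually
      (lt_mem_nhds (by simpa using har'))
  have h2 : ∀ᶠ ε : ℝ in 𝓝 0, Real.exp ε * r < b :=
    (by fun_prop : Continuous fun ε : ℝ => Real.exp ε * r).tendsto 0 |>.eventually
      (gt_mem_nhds (by simpa using hrb'))
  obtain ⟨ε, ⟨h1, h2⟩, hε⟩ := (((h1.and h2).filter_mono nhdsWithin_le_nhds).and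
    (self_mem_nhdsWithin : Ioi (0 : ℝ) ∈ 𝓝[>] 0)).exists
  obtain ⟨W, hW, hWU⟩ := UniformSpace.mem_nhds_iff.1 (hU.mem_nhds hr)
  refine mem_of_superset (UniformSpace.ball_mem_nhds x (entourage_mem_uniformity hW r hε)) ?_
  rintro y ⟨φ, hφ, h⟩
  obtain ⟨c, d⟩ := hφ 0 r bot_le
  have h0 : φ 0 = 0 := φ.map_bot
  simp only [h0, NNReal.coe_zero, sub_zero] at c d
  exact ⟨φ r, by exact_mod_cast h1.trans_le c, by exact_mod_cast d.trans_lt h2,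
    hWU (h r le_rfl)⟩

theorem measurable_eval {E : Type*} [UniformSpace E] [SecondCountableTopology E] (s : ℝ≥0) :
    Measurable[borel (SkorokhodSpace E), borel E] (fun x : SkorokhodSpace E => x s) := by
  borelize E (SkorokhodSpace E)
  refine measurable_of_isOpen fun U hU => ?_
  let B := TopologicalSpace.countableBasis E
  have hB : TopologicalSpace.IsTopologicalBasis B := TopologicalSpace.isBasis_countableBasis E
  -- By right continuity, `x s ∈ U` iff `x` stays in some basic `closure C ⊆ U` just after `s`. The
  -- closure is needed to recover `x s` as a limit from the right.
  have key : (fun x : SkorokhodSpace E => x s) ⁻¹' U =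
      ⋃ C ∈ {C ∈ B | closure C ⊆ U}, ⋃ n : ℕ,
        {x : SkorokhodSpace E | ∃ r, s < r ∧ r < s + 1 / (n + 1) ∧ x r ∈ (closure C)ᶜ}ᶜ := by
    ext x
    simp only [mem_preimage, mem_iUnion, mem_compl_iff, mem_ofPred_eq, not_exists, not_and, not_not,
      exists_prop]
    constructor
    · intro hx
      obtain ⟨C, hCB, hxC, hCU⟩ := hB.exists_closure_subset (hU.mem_nhds hx)
      have h1 : ∀ᶠ r in 𝓝[≥] s, x r ∈ C := x.isRCLL.1 s ((hB.isOpen hCB).mem_nhds hxC)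
      obtain ⟨u, hu, hu'⟩ := mem_nhdsGE_iff_exists_Ico_subset.1 h1
      obtain ⟨n, hn⟩ := exists_nat_one_div_lt (tsub_pos_of_lt (mem_Ioi.1 hu))
      refine ⟨C, ⟨hCB, hCU⟩, n, fun r h1 h2 => subset_closure (hu' ⟨h1.le, h2.trans ?_⟩)⟩
      rw [add_comm]
      exact lt_tsub_iff_right.1 hn
    · rintro ⟨C, ⟨-, hCU⟩, n, h⟩
      refine hCU (isClosed_closure.mem_of_tendsto (b := 𝓝[>] s)
        ((x.isRCLL.1 s).mono_left (nhdsWithin_mono s Ioi_subset_Ici_self)) ?_)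
      have : (s : ℝ≥0) < s + 1 / (n + 1) := lt_add_of_pos_right _ (by positivity)
      filter_upwards [self_mem_nhdsWithin, mem_nhdsWithin_of_mem_nhds (Iio_mem_nhds this)]
        with r h1 h2 using h r h1 h2
  rw [key]
  refine MeasurableSet.biUnion ((TopologicalSpace.countable_countableBasis E).mono
    (sep_subset _ _)) fun C _ => MeasurableSet.iUnion fun n => ?_
  exact (isOpen_setOf_exists_mem _ _ isClosed_closure.isOpen_compl).measurableSet.compl

/-- Inseparable paths lie in the same Borel sets, hence have inseparable values at each time. -/
instance t0Space {E : Type*} [UniformSpace E] [SecondCountableTopology E] [T0Space E] :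
    T0Space (SkorokhodSpace E) := by
  refine ⟨fun x y h => ?_⟩
  ext s
  borelize E (SkorokhodSpace E)
  refine Inseparable.eq (inseparable_iff_forall_isOpen.2 fun U hU => ?_)
  exact h.mem_measurableSet_iff (measurable_eval s hU.measurableSet)

/-- A right-continuous path is determined by its values on a dense set of times. -/
theorem ext_of_dense {E : Type*} [TopologicalSpace E] [T2Space E] {D : Set ℝ≥0} (hD : Dense D)
    {x y : SkorokhodSpace E} (h : ∀ s ∈ D, x s = y s) : x = y := by
  ext s
  have hne : (𝓝[Ioi s ∩ D] s).NeBot := by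
    rw [← mem_closure_iff_nhdsWithin_neBot]
    refine closure_minimal (hD.open_subset_closure_inter isOpen_Ioi) isClosed_closure ?_
    rw [closure_Ioi]
    exact self_mem_Ici
  have hle : 𝓝[Ioi s ∩ D] s ≤ 𝓝[≥] s :=
    nhdsWithin_mono s (inter_subset_left.trans Ioi_subset_Ici_self)
  refine tendsto_nhds_unique ((x.isRCLL.1 s).mono_left hle)
    (((y.isRCLL.1 s).mono_left hle).congr' ?_)
  filter_upwards [self_mem_nhdsWithin] with r hr using (h r hr.2).symm

theorem polishSpace (E : Type*) [UniformSpace E] [CompleteSpace E] [(𝓤 E).IsCountablyGenerated]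
    [T0Space E] [TopologicalSpace.SeparableSpace E] : PolishSpace (SkorokhodSpace E) := by
  have := UniformSpace.secondCountable_of_separable E
  infer_instance

/-- The Borel σ-algebra of the Skorokhod space is generated by the evaluations. -/
theorem borel_eq_iSup_eval (E : Type*) [UniformSpace E] [CompleteSpace E]
    [(𝓤 E).IsCountablyGenerated] [T0Space E] [TopologicalSpace.SeparableSpace E] :
    borel (SkorokhodSpace E) =
      ⨆ s : ℝ≥0, (borel E).comap (fun x : SkorokhodSpace E => x s) := by
  have := UniformSpace.secondCountable_of_separable E
  have := polishSpace E
  refine le_antisymm ?_ (iSup_le fun s => (measurable_eval s).comap_le)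
  borelize E (SkorokhodSpace E)
  obtain ⟨D, hDc, hD⟩ := TopologicalSpace.exists_countable_dense ℝ≥0
  have := hDc.to_subtype
  let f : SkorokhodSpace E → (D → E) := fun x s => x s
  have hf : Measurable f := measurable_pi_lambda _ fun s => measurable_eval (s : ℝ≥0)
  have hinj : Function.Injective f := fun x y h =>
    ext_of_dense hD fun s hs => congrFun h ⟨s, hs⟩
  -- Lusin–Souslin: a measurable injection of a Polish space into the countable product `D → E` is a
  -- measurable embedding.
  refine (hf.measurableEmbedding hinj).comap_eq.ge.trans ?_
  rw [MeasurableSpace.pi, MeasurableSpace.comap_iSup]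
  refine iSup_le fun s => ?_
  rw [MeasurableSpace.comap_comp]
  exact le_iSup (fun s : ℝ≥0 => (borel E).comap fun x : SkorokhodSpace E => x s) (s : ℝ≥0)

theorem comap_theta_borel (E : Type*) [UniformSpace E] [CompleteSpace E]
    [(𝓤 E).IsCountablyGenerated] [T0Space E] [TopologicalSpace.SeparableSpace E] (t : ℝ≥0) :
    (borel (SkorokhodSpace E)).comap (theta t) = evalSigma E t := by
  rw [borel_eq_iSup_eval, MeasurableSpace.comap_iSup]
  simp_rw [MeasurableSpace.comap_comp]
  refine le_antisymm (iSup_le fun s => ?_) (iSup_le fun s => ?_)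
  · exact le_iSup (fun s : Iic t => (borel E).comap fun x : SkorokhodSpace E => x s)
      ⟨min s t, mem_Iic.2 (min_le_right _ _)⟩
  · refine le_trans (le_of_eq ?_) (le_iSup _ (s : ℝ≥0))
    congr 1
    ext x
    simp [theta, min_eq_left (mem_Iic.1 s.2)]

theorem filtration_eq_evalSigma (E : Type*) [UniformSpace E] [CompleteSpace E]
    [(𝓤 E).IsCountablyGenerated] [T0Space E] [TopologicalSpace.SeparableSpace E] (t : ℝ≥0) :
    filtration E t = evalSigma E t := by
  rw [← comap_theta_borel, filtration, instTopologicalSpaceSubtype, borel_comap,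
    MeasurableSpace.comap_comp]
  rfl

/-- Stopping at `t` need not be continuous at a path that jumps at `t`; measurability comes from the
evaluations instead. -/
theorem measurable_theta (E : Type*) [UniformSpace E] [CompleteSpace E]
    [(𝓤 E).IsCountablyGenerated] [T0Space E] [TopologicalSpace.SeparableSpace E] (t : ℝ≥0) :
    Measurable[borel (SkorokhodSpace E), borel (SkorokhodSpace E)] (theta (E := E) t) := by
  rw [measurable_iff_comap_le, comap_theta_borel, borel_eq_iSup_eval]
  exact iSup_le fun s => le_iSup (fun s : ℝ≥0 => (borel E).comap
    fun x : SkorokhodSpace E => x s) (s : ℝ≥0)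

/-! ### The process of stopped paths -/

theorem comap_xiStar_borel (E : Type*) [UniformSpace E] [CompleteSpace E]
    [(𝓤 E).IsCountablyGenerated] [T0Space E] [TopologicalSpace.SeparableSpace E] (t : ℝ≥0) :
    (borel (EStar E)).comap (xiStar t) = evalSigma E t := by
  have := polishSpace E
  borelize (SkorokhodSpace E)
  rw [← BorelSpace.measurable_eq (α := EStar E), Prod.instMeasurableSpace,
    MeasurableSpace.prod, MeasurableSpace.comap_sup, MeasurableSpace.comap_comp, MeasurableSpace.comap_comp,
    ← comap_theta_borel]
  change MeasurableSpace.comap (fun _ => t) _ ⊔ MeasurableSpace.comap (theta t) _ = _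
  -- The time coordinate is constant in `x` and contributes only the trivial σ-algebra.
  rw [MeasurableSpace.comap_const, bot_sup_eq]

/-- The path stopped just before time `t`, with left limit `l` at `t`. -/
noncomputable def stopBefore {E : Type*} [TopologicalSpace E] (x : SkorokhodSpace E) (t : ℝ≥0)
    (l : E) (hl : Tendsto x (𝓝[<] t) (𝓝 l)) : SkorokhodSpace E where
  toFun s := if s < t then x s else l
  isRCLL := by
    refine ⟨fun s => ?_, fun s hs => ?_⟩
    · rcases lt_or_ge s t with h | h
      · refine (x.isRCLL.1 s).congr_of_eventuallyEq ?_ (if_pos h)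
        filter_upwards [mem_nhdsWithin_of_mem_nhds (Iio_mem_nhds h)] with r hr using if_pos hr
      · exact continuousWithinAt_const.congr (fun r hr => if_neg (not_lt.2 (h.trans hr)))
          (if_neg (not_lt.2 h))
    · rcases lt_trichotomy s t with h | rfl | h
      · obtain ⟨m, hm⟩ := x.isRCLL.2 s hs
        refine ⟨m, hm.congr' ?_⟩
        filter_upwards [self_mem_nhdsWithin] with r hr
        exact (if_pos (lt_trans hr h)).symm
      · refine ⟨l, hl.congr' ?_⟩
        filter_upwards [self_mem_nhdsWithin] with r hr using (if_pos hr).symm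
      · refine ⟨l, tendsto_const_nhds.congr' ?_⟩
        filter_upwards [mem_nhdsWithin_of_mem_nhds (Ioi_mem_nhds h)] with r hr
        exact (if_neg (not_lt.2 (le_of_lt hr))).symm

/-- No time change is needed: the two paths agree before `s`, and from `s` on both stay near `l`. -/
theorem tendsto_theta_nhdsLT {E : Type*} [UniformSpace E] (x : SkorokhodSpace E) (t : ℝ≥0)
    (ht : 0 < t) (l : E) (hl : Tendsto x (𝓝[<] t) (𝓝 l)) :
    Tendsto (fun s => theta s x) (𝓝[<] t) (𝓝 (stopBefore x t l hl)) := by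
  rw [Uniform.tendsto_nhds_left, Filter.tendsto_def]
  intro V hV
  obtain ⟨U, hU, T, ε, hε, hUV⟩ := exists_entourage_subset hV
  obtain ⟨W, hW, hWs, hWU⟩ := comp_symm_mem_uniformity_sets hU
  have h1 : ∀ᶠ r in 𝓝[<] t, (x r, l) ∈ W := (Uniform.tendsto_nhds_left.1 hl) hW
  obtain ⟨δ, hδ, hδ'⟩ := (mem_nhdsLT_iff_exists_Ioo_subset' ht).1 h1
  filter_upwards [Ioo_mem_nhdsLT hδ] with s hs
  refine hUV (mem_entourage_of_forall hε.le fun r _ => ?_)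
  have hsW : (x s, l) ∈ W := hδ' hs
  change (x (min r s), if r < t then x r else l) ∈ U
  split_ifs with hrt
  · rcases le_total r s with hrs | hrs
    · rw [min_eq_left hrs]; exact refl_mem_uniformity hU
    · rw [min_eq_right hrs]
      exact hWU ⟨l, hsW, SetRel.symm W (hδ' ⟨hs.1.trans_le hrs, hrt⟩)⟩
  · rw [min_eq_right (hs.2.le.trans (not_lt.1 hrt))]
    exact hWU ⟨l, hsW, refl_mem_uniformity hW⟩

theorem continuousWithinAt_theta {E : Type*} [UniformSpace E] (x : SkorokhodSpace E) (t : ℝ≥0) :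
    ContinuousWithinAt (fun s => theta s x) (Ici t) t := by
  rw [ContinuousWithinAt, Uniform.tendsto_nhds_left, Filter.tendsto_def]
  intro V hV
  obtain ⟨U, hU, T, ε, hε, hUV⟩ := exists_entourage_subset hV
  have h1 : ∀ᶠ r in 𝓝[≥] t, (x r, x t) ∈ U := (Uniform.tendsto_nhds_left.1 (x.isRCLL.1 t)) hU
  obtain ⟨u, hu, hu'⟩ := mem_nhdsGE_iff_exists_Ico_subset.1 h1
  filter_upwards [Ico_mem_nhdsGE (mem_Ioi.1 hu)] with s hs
  refine hUV (mem_entourage_of_forall hε.le fun r _ => ?_)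
  change (x (min r s), x (min r t)) ∈ U
  rcases le_total r t with hrt | hrt
  · rw [min_eq_left hrt, min_eq_left (hrt.trans hs.1)]
    exact refl_mem_uniformity hU
  · rw [min_eq_right hrt]
    exact hu' ⟨le_min hrt hs.1, (min_le_right _ _).trans_lt hs.2⟩

theorem isRCLL_xiStar {E : Type*} [UniformSpace E] (x : SkorokhodSpace E) :
    IsRCLL (fun t => xiStar t x) := by
  refine ⟨fun t => continuousWithinAt_id.prodMk (continuousWithinAt_theta x t), fun t ht => ?_⟩
  obtain ⟨l, hl⟩ := x.isRCLL.2 t ht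
  exact ⟨(t, stopBefore x t l hl), (tendsto_nhds_of_tendsto_nhdsWithin tendsto_id).prodMk_nhds
    (tendsto_theta_nhdsLT x t ht l hl)⟩

theorem comap_evalSigma_eStar (E : Type*) [UniformSpace E] [CompleteSpace E]
    [(𝓤 E).IsCountablyGenerated] [T0Space E] [TopologicalSpace.SeparableSpace E] (t : ℝ≥0) :
    (evalSigma (EStar E) t).comap
      (fun x => (⟨fun s => xiStar s x, isRCLL_xiStar x⟩ : SkorokhodSpace (EStar E))) =
      evalSigma E t := by
  rw [evalSigma, MeasurableSpace.comap_iSup]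
  simp_rw [MeasurableSpace.comap_comp]
  change ⨆ s : Iic t, (borel (EStar E)).comap (xiStar (s : ℝ≥0)) = _
  simp_rw [comap_xiStar_borel]
  refine le_antisymm (iSup_le fun s => iSup_le fun r => ?_) ?_
  · exact le_iSup (fun s : Iic t => (borel E).comap fun x : SkorokhodSpace E => x s)
      ⟨r, mem_Iic.2 (le_trans (mem_Iic.1 r.2) (mem_Iic.1 s.2))⟩
  -- The σ-algebras increase with `s`, so the term `s = t` already gives the supremum.
  · exact le_iSup (fun s : Iic t => evalSigma E s) ⟨t, self_mem_Iic⟩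

end SkorokhodSpace

/-! ### Assembling the theorem -/

theorem mainTheorem3 (E : Type*) [MetricSpace E] [CompleteSpace E]
    [TopologicalSpace.SeparableSpace E] :
    PolishSpace (SkorokhodSpace E) ∧ PolishSpace (SkorokhodSpace.EStar E) ∧
    (∀ t : ℝ≥0, Measurable[borel (SkorokhodSpace E), borel (SkorokhodSpace.EStar E)]
      (fun x : SkorokhodSpace E => SkorokhodSpace.xiStar t x)) ∧
    ∃ hξ : ∀ x : SkorokhodSpace E, IsRCLL (fun t => SkorokhodSpace.xiStar t x),
      ∀ t : ℝ≥0,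
        (SkorokhodSpace.filtration (SkorokhodSpace.EStar E) t).comap
            (fun x => (⟨fun s => SkorokhodSpace.xiStar s x, hξ x⟩ : SkorokhodSpace (SkorokhodSpace.EStar E))) =
          SkorokhodSpace.filtration E t ∧
        SkorokhodSpace.filtration E t = SkorokhodSpace.evalSigma E t ∧
        SkorokhodSpace.filtration (SkorokhodSpace.EStar E) t = SkorokhodSpace.evalSigma (SkorokhodSpace.EStar E) t := by
  have := SkorokhodSpace.polishSpace E
  have h := SkorokhodSpace.filtration_eq_evalSigma E
  have h' := SkorokhodSpace.filtration_eq_evalSigma (SkorokhodSpace.EStar E)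
  refine ⟨this, inferInstance, fun t => ?_, SkorokhodSpace.isRCLL_xiStar, fun t =>
    ⟨?_, h t, h' t⟩⟩
  · rw [measurable_iff_comap_le]
    refine (SkorokhodSpace.comap_xiStar_borel E t).trans_le ?_
    rw [← SkorokhodSpace.comap_theta_borel]
    exact (SkorokhodSpace.measurable_theta E t).comap_le
  · rw [h, h', SkorokhodSpace.comap_evalSigma_eStar]
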